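/- Let $n\ge 0$, let $v=v^i\partial_i$ be a smooth ($C^\infty$) vector field on $\mathbb{R}^{n+1}$, and let $p$ be a non-critical point of $v$, i.e. $v(p)\neq 0$. Then there are an open neighbourhood $U$ of $p$, a function $\Phi\in C^2(U)$, and $n$ smooth ($C^\infty$) contravariant 2-tensor fields $\Lambda_{(1)},\dots,\Lambda_{(n)}$ on $U$ such that the following hold, with summation over repeated upper and lower indices. 1. Each $\Lambda=\Lambda_{(k)}$ is a Poisson tensor on $U$: for all indices $i,j,l$, $$\Lambda^{ij}+\Lambda^{ji}=0,\qquad \Lambda^{it}\partial_t\Lambda^{jl}+\Lambda^{jt}\partial_t\Lambda^{li}+\Lambda^{lt}\partial_t\Lambda^{ij}=0 .$$ 2. Each $\Lambda_{(k)}$ has rank $2$ at every point of $U$. 3. The $\Lambda_{(k)}$ are independent: at every point $x\in U$ the tensors $\Lambda_{(1)}(x),\dots,\Lambda_{(n)}(x)$ are linearly independent, and for $k\neq l$ the symplectic leaves of $\Lambda_{(k)}$ and $\Lambda_{(l)}$ through $x$ are different, so that the tensors determine pairwise different symplectic foliations of $U$. Here the symplectic leaf of $\Lambda$ through $x$ is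 the set of points of $U$ that can be reached from $x$ by a finite chain of integral curves, lying in $U$, of Hamiltonian vector fields $\Lambda^{ij}\partial_jH$ with $H\in C^\infty(U)$. 4. For every $k=1,\dots,n$, on all of $U$, $$v^i=\Lambda_{(k)}^{ij}\,\partial_j\Phi ,\qquad i=0,\dots,n.$$ So $v$ is locally Hamiltonian, with the same Hamiltonian $\Phi$, with respect to $n$ different Poisson structures at once. -/

import Mathlib

open scoped ContDiff

noncomputable section

namespace LocalPoisson

/-- The partial derivative `∂_j f` at `x`, for a real function `f` on `ℝ^m`. -/
def pderiv {m : ℕ} (j : Fin m) (f : (Fin m → ℝ) → ℝ) (x : Fin m → ℝ) : ℝ :=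
  fderiv ℝ f x (Pi.single j 1)

/-- The vector field `Λ^{ij} ∂_j H` (sum over `j`) that the function `H` generates through the
contravariant 2-tensor field `Λ`. -/
def hamiltonianField {m : ℕ} (Λ : (Fin m → ℝ) → Matrix (Fin m) (Fin m) ℝ)
    (H : (Fin m → ℝ) → ℝ) (x : Fin m → ℝ) : Fin m → ℝ :=
  fun i => ∑ j, Λ x i j * pderiv j H x

/-- `Λ` is a smooth Poisson tensor on the open set `U`. -/
structure IsPoissonOn {m : ℕ} (Λ : (Fin m → ℝ) → Matrix (Fin m) (Fin m) ℝ)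
    (U : Set (Fin m → ℝ)) : Prop where
  smooth : ∀ i j, ContDiffOn ℝ ∞ (fun x => Λ x i j) U
  antisymm : ∀ x ∈ U, ∀ i j, Λ x i j + Λ x j i = 0
  jacobi : ∀ x ∈ U, ∀ i j k,
    ∑ t, (Λ x i t * pderiv t (fun y => Λ y j k) x
      + Λ x j t * pderiv t (fun y => Λ y k i) x
      + Λ x k t * pderiv t (fun y => Λ y i j) x) = 0

/-- `y` is reached from `x` by following, inside `U` and for a finite time, an integral curve of
the Hamiltonian vector field of some smooth function on `U`. -/
def HamiltonianStep {m : ℕ} (Λ : (Fin m → ℝ) → Matrix (Fin m) (Fin m) ℝ)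
    (U : Set (Fin m → ℝ)) (x y : Fin m → ℝ) : Prop :=
  ∃ (H : (Fin m → ℝ) → ℝ) (γ : ℝ → (Fin m → ℝ)) (T : ℝ),
    ContDiffOn ℝ ∞ H U ∧ 0 ≤ T ∧ γ 0 = x ∧ γ T = y ∧
    ∀ t ∈ Set.Icc 0 T,
      γ t ∈ U ∧ HasDerivWithinAt γ (hamiltonianField Λ H (γ t)) (Set.Icc 0 T) t

/-- The symplectic leaf through `x` of the Poisson tensor `Λ` on `U`: the points that can be
joined to `x` in `U` by a finite chain of integral curves of Hamiltonian vector fields. The leaves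
form the symplectic foliation of `U`. -/
def symplecticLeaf {m : ℕ} (Λ : (Fin m → ℝ) → Matrix (Fin m) (Fin m) ℝ)
    (U : Set (Fin m → ℝ)) (x : Fin m → ℝ) : Set (Fin m → ℝ) :=
  {y | Relation.ReflTransGen (HamiltonianStep Λ U) x y}

/-- Independence of a family of Poisson tensors on `U`: at each point the tensors are linearly
independent, and the symplectic leaves through each point are pairwise different (so the tensors
determine pairwise different symplectic foliations). -/
structure IndependentOn {m : ℕ} {ι : Type*}
    (Λ : ι → (Fin m → ℝ) → Matrix (Fin m) (Fin m) ℝ) (U : Set (Fin m → ℝ)) : Prop where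
  linearIndependent : ∀ x ∈ U, LinearIndependent ℝ (fun k => Λ k x)
  leaf_ne : ∀ x ∈ U, ∀ k l, k ≠ l → symplecticLeaf (Λ k) U x ≠ symplecticLeaf (Λ l) U x

end LocalPoisson

end

/-!
Near a non-critical point the field `v` can be straightened: there are smooth coordinates
`y 0, …, y n` with `v = ∂_0` (`exists_flowBox`). In them the constant bivectors `∂_0 ∧ ∂_k`,
`k = 1, …, n`, do what is required, with the common Hamiltonian `Φ = y 1 + ⋯ + y n`.

* Contracting `∂_0 ∧ ∂_k` with `dΦ` gives `∂_k Φ • ∂_0 - ∂_0 Φ • ∂_k = ∂_0 = v`.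
* The Jacobi identity holds because coordinate fields commute (`isPoissonOn_wedge`,
  `fderiv_coordFrame_comm`), and the image of `∂_0 ∧ ∂_k` is the plane of `∂_0` and `∂_k`
  (`rank_wedge`).
* Contracting with `dy l` separates the tensors, whence their linear independence. Their leaves
  differ since `y k` is constant on the leaves of `∂_0 ∧ ∂_l` for `l ≠ k`
  (`eq_of_mem_symplecticLeaf_wedge`), but not on those of `∂_0 ∧ ∂_k`, where `-y 0` generates the
  translations along `y k` (`exists_mem_symplecticLeaf_coord_ne`).

The analytic ingredient is a local flow of `v` that is smooth in time and initial value jointly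
(`exists_contDiffOn_localFlow`). It comes from the inverse function theorem in the Banach space of
curves `γ : [-1, 1] → E`, applied to the equation `γ t = x + s ∫₀ᵗ v (γ r) dr`, which is trivial to
solve at `s = 0`. The equation is smooth in `(s, x, γ)` because the superposition operator
`γ ↦ v ∘ γ` is (`contDiff_comp_left`). Uniqueness of the local solution shows that the curve for
`c * s` is the curve for `s` run at speed `c`, so its value at `t = 1` is the flow at time `s`.
-/

namespace LocalPoisson

open Set Metric Filter Topology

/-! ### Smoothness of the superposition operator -/

section Superposition

variable {K : Type*} [TopologicalSpace K] [CompactSpace K]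
  {E F : Type} [NormedAddCommGroup E] [NormedSpace ℝ E] [NormedAddCommGroup F] [NormedSpace ℝ F]

/-- Pointwise application of a continuous family of operators to a continuous family of vectors,
as a continuous bilinear map. -/
noncomputable def pointwiseApply (K E F : Type*) [TopologicalSpace K] [CompactSpace K]
    [NormedAddCommGroup E] [NormedSpace ℝ E] [NormedAddCommGroup F] [NormedSpace ℝ F] :
    C(K, E →L[ℝ] F) →L[ℝ] C(K, E) →L[ℝ] C(K, F) :=
  LinearMap.mkContinuous₂
    (LinearMap.mk₂ ℝ
      (fun (A : C(K, E →L[ℝ] F)) (h : C(K, E)) => (⟨fun t => A t (h t), by fun_prop⟩ : C(K, F)))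
      (fun _ _ _ => by ext; simp) (fun _ _ _ => by ext; simp)
      (fun _ _ _ => by ext; simp) (fun _ _ _ => by ext; simp)) 1 fun A h => by
    rw [one_mul, ContinuousMap.norm_le _ (by positivity)]
    exact fun t => (A t).le_of_opNorm_le_of_le (A.norm_coe_le_norm t) (h.norm_coe_le_norm t)

/-- The derivative of `γ ↦ f ∘ γ` is pointwise application of `f' ∘ γ`. The uniformity in the
point of `K` comes from continuity of `γ ↦ f' ∘ γ` in the supremum norm. -/
theorem hasFDerivAt_comp_left (f : C(E, F)) (f' : C(E, E →L[ℝ] F))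
    (hf : ∀ x, HasFDerivAt f (f' x) x) (γ : C(K, E)) :
    HasFDerivAt (fun γ : C(K, E) => f.comp γ) (pointwiseApply K E F (f'.comp γ)) γ := by
  rw [hasFDerivAt_iff_isLittleO_nhds_zero, Asymptotics.isLittleO_iff]
  intro c hc
  have hcont : Continuous fun γ : C(K, E) => f'.comp γ := f'.continuous_postcomp
  obtain ⟨δ, hδ, hball⟩ :=
    (Metric.continuous_iff (α := C(K, E)) (β := C(K, E →L[ℝ] F))).1 hcont γ c hc
  filter_upwards [Metric.ball_mem_nhds (0 : C(K, E)) hδ] with h hh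
  rw [mem_ball_zero_iff] at hh
  rw [ContinuousMap.norm_le _ (by positivity)]
  intro t
  have key := (convex_segment (γ t) (γ t + h t)).norm_image_sub_le_of_norm_hasFDerivWithin_le'
    (f := f) (f' := f') (φ := f' (γ t)) (C := c) (fun x _ => (hf x).hasFDerivWithinAt) ?_
    (left_mem_segment ℝ _ _) (right_mem_segment ℝ _ _)
  · simp only [add_sub_cancel_left] at key
    exact key.trans (mul_le_mul_of_nonneg_left (h.norm_coe_le_norm t) hc.le)
  · intro x hx
    rw [segment_eq_image'] at hx
    obtain ⟨a, ⟨ha0, ha1⟩, rfl⟩ := hx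
    have hlt := hball (γ + a • h) (by
      rw [dist_eq_norm, add_sub_cancel_left, norm_smul, Real.norm_of_nonneg ha0]
      exact (mul_le_of_le_one_left (norm_nonneg _) ha1).trans_lt hh)
    have := (ContinuousMap.dist_apply_le_dist t).trans hlt.le
    simpa [dist_eq_norm] using this

/-- Induction on the order: the derivative is a continuous linear function of the superposition
operator of `fderiv ℝ f`. -/
theorem contDiff_nat_comp_left (n : ℕ) : ∀ {F : Type} [NormedAddCommGroup F] [NormedSpace ℝ F]
    (f : C(E, F)), ContDiff ℝ ∞ f → ContDiff ℝ n (fun γ : C(K, E) => f.comp γ) := by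
  induction n with
  | zero =>
    intro F _ _ f _
    exact contDiff_zero.2 f.continuous_postcomp
  | succ n ih =>
    intro F _ _ f hf
    have hf' : ContDiff ℝ ∞ (fderiv ℝ f) := hf.fderiv_right (by simp)
    refine (contDiff_succ_iff_hasFDerivAt (n := (n : ℕ))).2
      ⟨_, (pointwiseApply K E F).contDiff.comp (ih ⟨fderiv ℝ f, hf'.continuous⟩ hf'), fun γ => ?_⟩
    exact hasFDerivAt_comp_left f ⟨fderiv ℝ f, hf'.continuous⟩
      (fun x => (hf.differentiable (by simp) x).hasFDerivAt) γ

theorem contDiff_comp_left (f : C(E, F)) (hf : ContDiff ℝ ∞ f) :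
    ContDiff ℝ ∞ (fun γ : C(K, E) => f.comp γ) :=
  contDiff_infty.2 fun n => contDiff_nat_comp_left n f hf

end Superposition

/-! ### The inverse function theorem on a neighbourhood -/

/-- For a `C^∞` map with invertible derivative at a point, the local inverse is `C^∞` on a whole
neighbourhood. This is more than `ContDiffAt ℝ ∞` at the image point, which only provides a
neighbourhood depending on the order for each finite order of differentiability. -/
theorem exists_openPartialHomeomorph_contDiffOn_symm {E F : Type*} [NormedAddCommGroup E]
    [NormedSpace ℝ E] [CompleteSpace E] [NormedAddCommGroup F] [NormedSpace ℝ F]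
    {f : E → F} {s : Set E} (hs : IsOpen s) (hf : ContDiffOn ℝ ∞ f s) {a : E} (ha : a ∈ s)
    (f' : E ≃L[ℝ] F) (hf' : HasFDerivAt f (f' : E →L[ℝ] F) a) :
    ∃ e : OpenPartialHomeomorph E F, a ∈ e.source ∧ e.source ⊆ s ∧ (⇑e = f) ∧
      ContDiffOn ℝ ∞ e.symm e.target := by
  have hfa : ContDiffAt ℝ ∞ f a := hf.contDiffAt (hs.mem_nhds ha)
  let e₀ := hfa.toOpenPartialHomeomorph f hf' (by simp)
  -- invertibility of the derivative is an open condition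
  let T : Set E := s ∩ fderiv ℝ f ⁻¹' range ((↑) : (E ≃L[ℝ] F) → E →L[ℝ] F)
  have hT : IsOpen T :=
    (hf.continuousOn_fderiv_of_isOpen hs (by simp)).isOpen_inter_preimage hs
      ContinuousLinearEquiv.isOpen
  have haT : a ∈ T := ⟨ha, f', hf'.fderiv.symm⟩
  refine ⟨e₀.restrOpen T hT, ⟨hfa.mem_toOpenPartialHomeomorph_source hf' (by simp), haT⟩,
    fun x hx => hx.2.1, rfl, fun y hy => ?_⟩
  have hx := (e₀.restrOpen T hT).map_target hy
  obtain ⟨hxs, A, hA⟩ := hx.2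
  have hxf := hf.contDiffAt (hs.mem_nhds hxs)
  refine ((e₀.restrOpen T hT).contDiffAt_symm (f₀' := A) hy ?_ hxf).contDiffWithinAt
  rw [hA]
  exact (hxf.differentiableAt (by simp)).hasFDerivAt

/-! ### Smooth dependence of local flows on the initial value -/

section Flow

variable {E : Type} [NormedAddCommGroup E]

/-- The parameter interval of the rescaled integral curves. -/
abbrev CurveInterval : Set ℝ := Icc (-1) 1

/-- A curve on `[-1, 1]`, extended to `ℝ` by constants. -/
noncomputable def extendCurve (γ : C(CurveInterval, E)) : ℝ → E :=
  IccExtend (by norm_num : (-1 : ℝ) ≤ 1) γ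

theorem continuous_extendCurve (γ : C(CurveInterval, E)) : Continuous (extendCurve γ) :=
  γ.continuous.Icc_extend'

theorem extendCurve_of_mem (γ : C(CurveInterval, E)) {t : ℝ} (ht : t ∈ CurveInterval) :
    extendCurve γ t = γ ⟨t, ht⟩ := IccExtend_of_mem _ _ ht

theorem norm_extendCurve_le (γ : C(CurveInterval, E)) (t : ℝ) : ‖extendCurve γ t‖ ≤ ‖γ‖ :=
  γ.norm_coe_le_norm _

variable [NormedSpace ℝ E]

/-- The constant curve at a point, as a continuous linear map. -/
noncomputable def constCurve (E : Type) [NormedAddCommGroup E] [NormedSpace ℝ E] :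
    E →L[ℝ] C(CurveInterval, E) :=
  LinearMap.mkContinuous
    { toFun := ContinuousMap.const CurveInterval
      map_add' := fun _ _ => rfl
      map_smul' := fun _ _ => rfl } 1 fun x => by
    rw [one_mul, ContinuousMap.norm_le _ (norm_nonneg _)]
    exact fun _ => le_rfl

@[simp]
theorem constCurve_apply (x : E) (t : CurveInterval) : constCurve E x t = x := rfl

variable [CompleteSpace E]

/-- The primitive `t ↦ ∫₀ᵗ γ` as a continuous linear operator on curves. -/
noncomputable def primitive (E : Type) [NormedAddCommGroup E] [NormedSpace ℝ E] [CompleteSpace E] :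
    C(CurveInterval, E) →L[ℝ] C(CurveInterval, E) :=
  LinearMap.mkContinuous
    { toFun := fun γ => (⟨fun t => ∫ s in (0 : ℝ)..t, extendCurve γ s,
        (intervalIntegral.continuous_primitive
          (fun a b => (continuous_extendCurve γ).intervalIntegrable a b) 0).comp
            continuous_subtype_val⟩ : C(CurveInterval, E))
      map_add' := fun γ η => by
        ext t
        exact intervalIntegral.integral_add ((continuous_extendCurve γ).intervalIntegrable _ _)
          ((continuous_extendCurve η).intervalIntegrable _ _)
      map_smul' := fun c γ => by
        ext t
        exact intervalIntegral.integral_smul c (extendCurve γ) } 1 fun γ => by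
    rw [one_mul, ContinuousMap.norm_le _ (norm_nonneg _)]
    intro t
    refine (intervalIntegral.norm_integral_le_of_norm_le_const
      (fun s _ => norm_extendCurve_le γ s)).trans ?_
    rw [sub_zero]
    exact mul_le_of_le_one_right (norm_nonneg _) (abs_le.2 t.2)

/-- The defect `γ - x - s ∫₀ v(γ)` of a curve `γ` in the integral equation for integral curves of
`s • v` with initial value `x`; the argument is `((s, x), γ)`. -/
noncomputable def picardDefect (v : C(E, E)) (q : (ℝ × E) × C(CurveInterval, E)) :
    C(CurveInterval, E) :=
  q.2 - constCurve E q.1.2 - q.1.1 • primitive E (v.comp q.2)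

theorem picardDefect_eq_zero_iff (v : C(E, E)) (s : ℝ) (x : E) (γ : C(CurveInterval, E)) :
    picardDefect v ((s, x), γ) = 0 ↔
      ∀ t : CurveInterval, γ t = x + s • ∫ r in (0 : ℝ)..t, v (extendCurve γ r) := by
  rw [ContinuousMap.ext_iff]
  refine forall_congr' fun t => ?_
  rw [← sub_eq_zero (b := x + _), ← sub_sub]
  rfl

theorem contDiff_picardDefect (v : C(E, E)) (hv : ContDiff ℝ ∞ v) :
    ContDiff ℝ ∞ (picardDefect v) := by
  have h := (contDiff_comp_left (K := CurveInterval) v hv).comp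
    (contDiff_snd (𝕜 := ℝ) (E := ℝ × E) (F := C(CurveInterval, E)))
  have h' := (primitive E).contDiff.comp h
  have h'' := (constCurve E).contDiff.comp
    ((contDiff_snd (𝕜 := ℝ) (E := ℝ) (F := E) (n := ∞)).comp
      (contDiff_fst (F := C(CurveInterval, E))))
  exact (contDiff_snd.sub h'').sub ((contDiff_fst.comp contDiff_fst).smul h')

/-- At `s = 0` the integral term drops out of the derivative in `γ`, so that the derivative of
`q ↦ (q.1, picardDefect v q)` is unipotent, hence invertible. -/
theorem hasFDerivAt_prodMk_picardDefect (v : C(E, E)) (hv : ContDiff ℝ ∞ v) (p : E) :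
    ∃ A : ((ℝ × E) × C(CurveInterval, E)) ≃L[ℝ] ((ℝ × E) × C(CurveInterval, E)),
      HasFDerivAt (fun q => (q.1, picardDefect v q))
        (A : ((ℝ × E) × C(CurveInterval, E)) →L[ℝ] ((ℝ × E) × C(CurveInterval, E)))
        ((0, p), constCurve E p) := by
  let w : C(CurveInterval, E) := primitive E (v.comp (constCurve E p))
  let B : ℝ × E →L[ℝ] C(CurveInterval, E) :=
    -(constCurve E ∘L ContinuousLinearMap.snd ℝ ℝ E) -
      (ContinuousLinearMap.fst ℝ ℝ E).smulRight w
  refine ⟨(ContinuousLinearEquiv.refl ℝ (ℝ × E)).skewProd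
    (ContinuousLinearEquiv.refl ℝ C(CurveInterval, E)) B, ?_⟩
  have h1 : HasFDerivAt (fun q : (ℝ × E) × C(CurveInterval, E) => q.1)
      (ContinuousLinearMap.fst ℝ _ _) ((0, p), constCurve E p) := hasFDerivAt_fst
  have h2 : HasFDerivAt (fun q : (ℝ × E) × C(CurveInterval, E) => q.2)
      (ContinuousLinearMap.snd ℝ _ _) ((0, p), constCurve E p) := hasFDerivAt_snd
  have h3 : HasFDerivAt (fun q : (ℝ × E) × C(CurveInterval, E) => constCurve E q.1.2)
      (constCurve E ∘L ContinuousLinearMap.snd ℝ ℝ E ∘L ContinuousLinearMap.fst ℝ _ _)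
      ((0, p), constCurve E p) :=
    (constCurve E ∘L ContinuousLinearMap.snd ℝ ℝ E ∘L ContinuousLinearMap.fst ℝ (ℝ × E)
      C(CurveInterval, E)).hasFDerivAt
  have h4 : HasFDerivAt (fun q : (ℝ × E) × C(CurveInterval, E) => q.1.1)
      (ContinuousLinearMap.fst ℝ ℝ E ∘L ContinuousLinearMap.fst ℝ _ _)
      ((0, p), constCurve E p) :=
    (ContinuousLinearMap.fst ℝ ℝ E ∘L ContinuousLinearMap.fst ℝ (ℝ × E)
      C(CurveInterval, E)).hasFDerivAt
  have hN : Differentiable ℝ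
      (fun q : (ℝ × E) × C(CurveInterval, E) => primitive E (v.comp q.2)) :=
    ((primitive E).contDiff.comp ((contDiff_comp_left (K := CurveInterval) v hv).comp
      (contDiff_snd (𝕜 := ℝ) (E := ℝ × E) (F := C(CurveInterval, E))))).differentiable (by simp)
  refine (h1.prodMk ((h2.sub h3).sub (h4.smul (hN _).hasFDerivAt))).congr_fderiv ?_
  refine ContinuousLinearMap.ext fun q => Prod.ext rfl ?_
  simp [ContinuousLinearEquiv.skewProd, B, w]
  abel

/-- Reparametrizing a solution of the integral equation by `t ↦ c * t` solves the equation with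
`s` replaced by `c * s`. -/
theorem picardDefect_rescale_eq_zero (v : C(E, E)) {s : ℝ} {x : E} {γ : C(CurveInterval, E)}
    (h : picardDefect v ((s, x), γ) = 0) {c : ℝ} (φ : C(CurveInterval, CurveInterval))
    (hφ : ∀ t, (φ t : ℝ) = c * t) :
    picardDefect v ((c * s, x), γ.comp φ) = 0 := by
  rw [picardDefect_eq_zero_iff] at h ⊢
  intro t
  rw [ContinuousMap.comp_apply, h (φ t), hφ, mul_comm c s, mul_smul]
  congr 2
  rw [← mul_zero c, ← intervalIntegral.smul_integral_comp_mul_left, mul_zero]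
  congr 1
  refine intervalIntegral.integral_congr fun r hr => ?_
  have hr' : r ∈ CurveInterval :=
    (uIcc_subset_Icc ⟨by norm_num, by norm_num⟩ t.2) hr
  have hcr : c * r ∈ CurveInterval := hφ ⟨r, hr'⟩ ▸ (φ ⟨r, hr'⟩).2
  simp only [extendCurve_of_mem _ hr', extendCurve_of_mem _ hcr, ContinuousMap.comp_apply]
  congr 2
  exact Subtype.ext (hφ ⟨r, hr'⟩).symm

/-- A smooth vector field has a local flow near every point which is smooth in time and initial
value jointly. -/
theorem exists_contDiffOn_localFlow (v : E → E) (hv : ContDiff ℝ ∞ v) (p : E) :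
    ∃ (θ : ℝ × E → E) (ε : ℝ), 0 < ε ∧ ContDiffOn ℝ ∞ θ (ball 0 ε ×ˢ ball p ε) ∧
      (∀ x ∈ ball p ε, θ (0, x) = x) ∧
      ∀ s ∈ ball (0 : ℝ) ε, ∀ x ∈ ball p ε,
        HasDerivAt (fun t => θ (t, x)) (v (θ (s, x))) s := by
  let V : C(E, E) := ⟨v, hv.continuous⟩
  let P : C(CurveInterval, E) := constCurve E p
  obtain ⟨A, hA⟩ := hasFDerivAt_prodMk_picardDefect V hv p
  obtain ⟨e, hpe, -, he, hsymm⟩ := exists_openPartialHomeomorph_contDiffOn_symm isOpen_univ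
    (contDiff_fst.prodMk (contDiff_picardDefect V hv)).contDiffOn (mem_univ _) A hA
  have he' : ∀ q, e q = (q.1, picardDefect V q) := fun q => congrFun he q
  -- the solution operator `w = (s, x) ↦ Γ w`, with `Γ w` the curve `t ↦ flow (s * t) x`
  let Γ : ℝ × E → C(CurveInterval, E) := fun w => (e.symm (w, 0)).2
  let W : Set (ℝ × E) := {w | (w, (0 : C(CurveInterval, E))) ∈ e.target}
  have hWo : IsOpen W := e.open_target.preimage (by fun_prop)
  have hunique : ∀ w γ, (w, γ) ∈ e.source → picardDefect V (w, γ) = 0 → w ∈ W ∧ Γ w = γ := by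
    intro w γ hmem h0
    have h1 : e (w, γ) = (w, 0) := by rw [he', h0]
    refine ⟨show (w, 0) ∈ e.target from h1 ▸ e.map_source hmem, ?_⟩
    have := e.left_inv hmem
    rw [h1] at this
    exact congrArg Prod.snd this
  have hsol : ∀ w ∈ W, picardDefect V (w, Γ w) = 0 := by
    intro w hw
    have h1 := e.right_inv hw
    rw [he'] at h1
    have h2 : (e.symm (w, 0)).1 = w := congrArg Prod.fst h1
    have h3 := congrArg Prod.snd h1
    simp only at h3
    rwa [← Prod.mk.eta (p := e.symm (w, 0)), h2] at h3
  have hP0 : picardDefect V ((0, p), P) = 0 := by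
    rw [picardDefect_eq_zero_iff]; intro t; simp [P]
  obtain ⟨hpW, hΓp⟩ := hunique _ _ hpe hP0
  have hΓs : ContDiffOn ℝ ∞ Γ W :=
    contDiff_snd.comp_contDiffOn (hsymm.comp (by fun_prop) fun w hw => hw)
  obtain ⟨r, hr, hrs⟩ := Metric.isOpen_iff.1 e.open_source _ hpe
  have hev : ∀ᶠ w in 𝓝 ((0 : ℝ), p), w ∈ W ∧ Γ w ∈ ball P r :=
    (hWo.eventually_mem hpW).and ((hΓs.continuousOn.continuousAt (hWo.mem_nhds hpW)).eventually
      (by rw [hΓp]; exact ball_mem_nhds _ hr))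
  obtain ⟨δ, hδ, hball⟩ := Metric.eventually_nhds_iff_ball.1 (hev.and (ball_mem_nhds _ hr))
  have hscale : ∀ s ∈ ball (0 : ℝ) δ, ∀ x ∈ ball p δ, ∀ c : CurveInterval,
      Γ (c * s, x) ⟨1, by norm_num⟩ = Γ (s, x) c := by
    intro s hs x hx c
    have hw : (s, x) ∈ ball ((0 : ℝ), p) δ := by
      rw [← ball_prod_same]; exact ⟨hs, hx⟩
    obtain ⟨⟨hwW, hwr⟩, -⟩ := hball _ hw
    let φ : C(CurveInterval, CurveInterval) := ⟨fun t => ⟨c * t, by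
      have := abs_le.2 c.2
      have := abs_le.2 t.2
      refine abs_le.1 ?_
      rw [abs_mul]
      exact mul_le_one₀ ‹_› (abs_nonneg _) ‹_›⟩, by fun_prop⟩
    have hcs : (c * s, x) ∈ ball ((0 : ℝ), p) δ := by
      rw [← ball_prod_same]
      refine ⟨?_, hx⟩
      rw [mem_ball_zero_iff, norm_mul] at *
      exact (mul_le_of_le_one_left (norm_nonneg _) (abs_le.2 c.2)).trans_lt hs
    -- rescaling does not increase the distance to the constant curve, so uniqueness applies
    have hmem : ((c * s, x), (Γ (s, x)).comp φ) ∈ e.source := by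
      apply hrs
      rw [← ball_prod_same]
      refine ⟨(hball _ hcs).2, ?_⟩
      rw [mem_ball, ContinuousMap.dist_lt_iff hr]
      exact fun t => (ContinuousMap.dist_apply_le_dist (φ t)).trans_lt hwr
    rw [(hunique _ _ hmem (picardDefect_rescale_eq_zero V (hsol _ hwW) φ fun t => rfl)).2]
    exact congrArg (Γ (s, x)) (Subtype.ext (mul_one _))
  let one : CurveInterval := ⟨1, by norm_num⟩
  let θ : ℝ × E → E := fun w => Γ w one
  have hsub : ball (0 : ℝ) (δ / 2) ×ˢ ball p (δ / 2) ⊆ W := fun w hw =>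
    (hball w (by
      rw [← ball_prod_same]
      exact ⟨ball_subset_ball (by linarith) hw.1, ball_subset_ball (by linarith) hw.2⟩)).1.1
  refine ⟨θ, δ / 2, by positivity, ?_, ?_, ?_⟩
  · exact (ContinuousMap.evalCLM ℝ one).contDiff.comp_contDiffOn (hΓs.mono hsub)
  · intro x hx
    have := (picardDefect_eq_zero_iff V _ _ _).1
      (hsol (0, x) (hsub ⟨mem_ball_self (by positivity), hx⟩)) one
    simpa using this
  · intro s hs x hx
    have hδ2 : (0 : ℝ) < δ / 2 := by positivity
    -- all flow times in the ball are rescalings of the single time `δ / 2`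
    have hθ : ∀ t ∈ ball (0 : ℝ) (δ / 2), ∃ ht : t / (δ / 2) ∈ CurveInterval,
        θ (t, x) = Γ (δ / 2, x) ⟨t / (δ / 2), ht⟩ := by
      intro t ht
      rw [mem_ball_zero_iff, Real.norm_eq_abs, abs_lt] at ht
      have hmem : t / (δ / 2) ∈ CurveInterval :=
        ⟨by rw [le_div_iff₀ hδ2]; linarith, by rw [div_le_iff₀ hδ2]; linarith⟩
      refine ⟨hmem, ?_⟩
      rw [← hscale (δ / 2) (by
        rw [mem_ball_zero_iff, Real.norm_of_nonneg hδ2.le]; linarith) x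
        (ball_subset_ball (by linarith) hx)]
      simp [θ, one, div_mul_cancel₀ _ hδ2.ne']
    have hdW : (δ / 2, x) ∈ W := (hball _ (by
      rw [← ball_prod_same]
      exact ⟨by rw [mem_ball_zero_iff, Real.norm_of_nonneg hδ2.le]; linarith,
        ball_subset_ball (by linarith) hx⟩)).1.1
    have hint := (picardDefect_eq_zero_iff V _ _ _).1 (hsol _ hdW)
    set η := extendCurve (Γ (δ / 2, x)) with hη
    have hηc : Continuous fun r => v (η r) := hv.continuous.comp (continuous_extendCurve _)
    have hderiv : HasDerivAt (fun t => x + (δ / 2) • ∫ r in (0 : ℝ)..(t / (δ / 2)), v (η r))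
        (v (θ (s, x))) s := by
      have h1 := (hηc.integral_hasStrictDerivAt 0 (s / (δ / 2))).hasDerivAt
      have h2 := (h1.scomp s ((hasDerivAt_id s).div_const (δ / 2))).const_smul (δ / 2)
      refine (h2.const_add x).congr_deriv ?_
      obtain ⟨ht, hst⟩ := hθ s hs
      rw [smul_smul, mul_one_div_cancel hδ2.ne', one_smul, hst, hη, extendCurve_of_mem _ ht]
    refine hderiv.congr_of_eventuallyEq ?_
    filter_upwards [isOpen_ball.mem_nhds hs] with t ht
    obtain ⟨htm, h⟩ := hθ t ht
    rw [h, hint]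
    rfl

end Flow

/-! ### Flow boxes -/

/-- Near a non-critical point of a smooth vector field there are smooth coordinates in which the
field is the first coordinate field: follow the flow for the time `y 0`, starting from a
hyperplane through `p` that is transverse to `v p`. -/
theorem exists_flowBox (n : ℕ) (v : (Fin (n + 1) → ℝ) → (Fin (n + 1) → ℝ))
    (hv : ContDiff ℝ ∞ v) (p : Fin (n + 1) → ℝ) (hp : v p ≠ 0) :
    ∃ e : OpenPartialHomeomorph (Fin (n + 1) → ℝ) (Fin (n + 1) → ℝ), p ∈ e.target ∧
      ContDiffOn ℝ ∞ e e.source ∧ ContDiffOn ℝ ∞ e.symm e.target ∧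
      ∀ y ∈ e.source, fderiv ℝ e y (Pi.single 0 1) = v (e y) := by
  obtain ⟨θ, ε, hε, hθ, hθ0, hθv⟩ := exists_contDiffOn_localFlow v hv p
  let e₀ : Fin (n + 1) → ℝ := Pi.single 0 1
  have he₀ : e₀ ≠ 0 := by simp [e₀]
  obtain ⟨L, hL⟩ := SeparatingDual.exists_continuousLinearEquiv_apply_eq (R := ℝ) he₀ hp
  -- `θ ∘ g` is `y ↦ θ (y 0, p + L (y - y 0 • e₀))`, whose derivative at `0` is `L`
  let π : (Fin (n + 1) → ℝ) →L[ℝ] ℝ := ContinuousLinearMap.proj 0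
  let g' : (Fin (n + 1) → ℝ) →L[ℝ] ℝ × (Fin (n + 1) → ℝ) :=
    π.prod ((L : _ →L[ℝ] _) - π.smulRight (v p))
  let g : (Fin (n + 1) → ℝ) → ℝ × (Fin (n + 1) → ℝ) := fun y => (0, p) + g' y
  have hg : ContDiff ℝ ∞ g := contDiff_const.add g'.contDiff
  let S : Set (Fin (n + 1) → ℝ) := g ⁻¹' (ball 0 ε ×ˢ ball p ε)
  have hS : IsOpen S := (isOpen_ball.prod isOpen_ball).preimage hg.continuous
  have hg0 : g 0 = (0, p) := by simp [g]
  have h0 : (0 : Fin (n + 1) → ℝ) ∈ S := by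
    change g 0 ∈ ball (0 : ℝ) ε ×ˢ ball p ε
    rw [hg0]
    exact ⟨mem_ball_self hε, mem_ball_self hε⟩
  have hψ : ContDiffOn ℝ ∞ (θ ∘ g) S := hθ.comp hg.contDiffOn fun y hy => hy
  have hθd : ∀ w ∈ ball (0 : ℝ) ε ×ˢ ball p ε, HasFDerivAt θ (fderiv ℝ θ w) w := fun w hw =>
    ((hθ.contDiffAt ((isOpen_ball.prod isOpen_ball).mem_nhds hw)).differentiableAt
      (by simp)).hasFDerivAt
  have hgd : ∀ y, HasFDerivAt g g' y := fun y => g'.hasFDerivAt.const_add _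
  have hθt : ∀ w ∈ ball (0 : ℝ) ε ×ˢ ball p ε, fderiv ℝ θ w (1, 0) = v (θ w) := by
    rintro ⟨s, x⟩ hw
    have h1 : HasDerivAt (fun t : ℝ => (t, x)) (1, 0) s :=
      (hasDerivAt_id s).prodMk (hasDerivAt_const s x)
    exact (((hθd _ hw).comp_hasDerivAt s h1).unique (hθv s hw.1 x hw.2))
  have hp0 : ((0 : ℝ), p) ∈ ball (0 : ℝ) ε ×ˢ ball p ε := hg0 ▸ h0
  have hθx : ∀ h, fderiv ℝ θ (0, p) (0, h) = h := by
    intro h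
    have h1 : HasFDerivAt (fun x => θ (0, x))
        (fderiv ℝ θ (0, p) ∘L ContinuousLinearMap.inr ℝ ℝ _) p :=
      (hθd _ hp0).comp p (hasFDerivAt_prodMk_right 0 p)
    have h2 : HasFDerivAt (fun x => θ (0, x)) (ContinuousLinearMap.id ℝ _) p :=
      (hasFDerivAt_id p).congr_of_eventuallyEq (by
        filter_upwards [ball_mem_nhds p hε] with x hx using hθ0 x hx)
    exact DFunLike.congr_fun (h1.unique h2) h
  have hψ0 : HasFDerivAt (θ ∘ g) (L : (Fin (n + 1) → ℝ) →L[ℝ] (Fin (n + 1) → ℝ)) 0 := by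
    refine HasFDerivAt.congr_fderiv
      (HasFDerivAt.comp 0 (by rw [hg0]; exact hθd _ hp0) (hgd 0)) ?_
    ext1 h
    have hsplit : g' h = (π h) • ((1 : ℝ), (0 : Fin (n + 1) → ℝ)) + (0, L h - π h • v p) := by
      simp [g']
    rw [ContinuousLinearMap.comp_apply, hsplit, map_add, map_smul, hθx, hθt _ hp0, hθ0 p hp0.2]
    simp
  obtain ⟨e, h0e, heS, he, hes⟩ := exists_openPartialHomeomorph_contDiffOn_symm hS hψ h0 L hψ0
  refine ⟨e, ?_, he ▸ hψ.mono heS, hes, fun y hy => ?_⟩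
  · have h1 := e.map_source h0e
    rwa [he, Function.comp_apply, hg0, hθ0 p hp0.2] at h1
  · rw [he, ((hθd _ (heS hy)).comp y (hgd y)).fderiv, ContinuousLinearMap.comp_apply]
    have hd : g' (Pi.single 0 1) = (1, 0) := by
      have : L (Pi.single 0 1) = v p := hL
      simp [g', π, this]
    rw [hd, hθt _ (heS hy)]
    rfl

/-! ### Coordinate frames -/

section Frame

variable {m : ℕ}

/-- The `a`-th coordinate vector field, on the target, of the local parametrization `e`. -/
noncomputable def coordFrame (e : OpenPartialHomeomorph (Fin m → ℝ) (Fin m → ℝ)) (a : Fin m)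
    (x : Fin m → ℝ) : Fin m → ℝ :=
  fderiv ℝ e (e.symm x) (Pi.single a 1)

theorem contDiffOn_coordFrame {e : OpenPartialHomeomorph (Fin m → ℝ) (Fin m → ℝ)}
    (he : ContDiffOn ℝ ∞ e e.source) (hes : ContDiffOn ℝ ∞ e.symm e.target) (a : Fin m) :
    ContDiffOn ℝ ∞ (coordFrame e a) e.target :=
  ((he.fderiv_of_isOpen e.open_source (by simp)).comp hes e.symm.mapsTo).clm_apply
    contDiffOn_const

theorem fderiv_symm_coordFrame {e : OpenPartialHomeomorph (Fin m → ℝ) (Fin m → ℝ)}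
    (he : ContDiffOn ℝ ∞ e e.source) (hes : ContDiffOn ℝ ∞ e.symm e.target) (a : Fin m)
    {x : Fin m → ℝ} (hx : x ∈ e.target) :
    fderiv ℝ e.symm x (coordFrame e a x) = Pi.single a 1 := by
  have hy := e.map_target hx
  have h1 : HasFDerivAt e (fderiv ℝ e (e.symm x)) (e.symm x) :=
    ((he.contDiffAt (e.open_source.mem_nhds hy)).differentiableAt (by simp)).hasFDerivAt
  have h2 : HasFDerivAt e.symm (fderiv ℝ e.symm x) (e (e.symm x)) := by
    rw [e.right_inv hx]
    exact ((hes.contDiffAt (e.open_target.mem_nhds hx)).differentiableAt (by simp)).hasFDerivAt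
  have h3 : HasFDerivAt (e.symm ∘ e) (ContinuousLinearMap.id ℝ _) (e.symm x) :=
    (hasFDerivAt_id _).congr_of_eventuallyEq (by
      filter_upwards [e.open_source.mem_nhds hy] with y hy using e.left_inv hy)
  exact DFunLike.congr_fun ((h2.comp _ h1).unique h3) (Pi.single a 1)

/-- Coordinate fields commute, by symmetry of the second derivative of the parametrization. -/
theorem fderiv_coordFrame_comm {e : OpenPartialHomeomorph (Fin m → ℝ) (Fin m → ℝ)}
    (he : ContDiffOn ℝ ∞ e e.source) (hes : ContDiffOn ℝ ∞ e.symm e.target) (a b : Fin m)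
    {x : Fin m → ℝ} (hx : x ∈ e.target) :
    fderiv ℝ (coordFrame e a) x (coordFrame e b x) =
      fderiv ℝ (coordFrame e b) x (coordFrame e a x) := by
  have hy := e.map_target hx
  have hey := he.contDiffAt (e.open_source.mem_nhds hy)
  have h2 : DifferentiableAt ℝ (fderiv ℝ e) (e.symm x) :=
    (hey.fderiv_right (m := ∞) (by simp)).differentiableAt (by simp)
  have hs : HasFDerivAt e.symm (fderiv ℝ e.symm x) x :=
    ((hes.contDiffAt (e.open_target.mem_nhds hx)).differentiableAt (by simp)).hasFDerivAt
  have key : ∀ a b : Fin m, fderiv ℝ (coordFrame e a) x (coordFrame e b x) =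
      fderiv ℝ (fderiv ℝ e) (e.symm x) (Pi.single b 1) (Pi.single a 1) := by
    intro a b
    have h := (h2.hasFDerivAt.comp x hs).clm_apply
      (hasFDerivAt_const (Pi.single a 1 : Fin m → ℝ) x)
    have h' : HasFDerivAt (coordFrame e a) _ x := h
    rw [h'.fderiv]
    simp [fderiv_symm_coordFrame he hes b hx]
  rw [key, key]
  exact (hey.isSymmSndFDerivAt (by
    rw [minSmoothness_of_isRCLikeNormedField]
    exact WithTop.coe_le_coe.2 (le_top : (2 : ℕ∞) ≤ ⊤))) _ _

end Frame

/-! ### Poisson bivectors spanned by commuting fields -/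

section Bivector

variable {m : ℕ}

/-- The bivector field `u ∧ w`, as a field of skew-symmetric matrices. -/
def wedge (u w : (Fin m → ℝ) → Fin m → ℝ) (x : Fin m → ℝ) : Matrix (Fin m) (Fin m) ℝ :=
  Matrix.of fun i j => u x i * w x j - w x i * u x j

theorem sum_mul_pderiv (h : Fin m → ℝ) (f : (Fin m → ℝ) → ℝ) (x : Fin m → ℝ) :
    ∑ j, h j * pderiv j f x = fderiv ℝ f x h := by
  conv_rhs => rw [pi_eq_sum_univ' h, map_sum]
  simp only [pderiv, map_smul, smul_eq_mul]

theorem sum_wedge_mul_pderiv (u w : (Fin m → ℝ) → Fin m → ℝ) (f : (Fin m → ℝ) → ℝ)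
    (x : Fin m → ℝ) (i : Fin m) :
    ∑ j, wedge u w x i j * pderiv j f x =
      u x i * fderiv ℝ f x (w x) - w x i * fderiv ℝ f x (u x) := by
  rw [← sum_mul_pderiv, ← sum_mul_pderiv, Finset.mul_sum, Finset.mul_sum,
    ← Finset.sum_sub_distrib]
  exact Finset.sum_congr rfl fun j _ => by simp only [wedge, Matrix.of_apply]; ring

theorem fderiv_wedge_apply {u w : (Fin m → ℝ) → Fin m → ℝ} {x : Fin m → ℝ}
    (hu : DifferentiableAt ℝ u x) (hw : DifferentiableAt ℝ w x) (j k : Fin m) (h : Fin m → ℝ) :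
    fderiv ℝ (fun y => wedge u w y j k) x h =
      u x j * fderiv ℝ w x h k + w x k * fderiv ℝ u x h j
        - (w x j * fderiv ℝ u x h k + u x k * fderiv ℝ w x h j) := by
  have hu' := fun i => hasFDerivAt_pi'.1 hu.hasFDerivAt i
  have hw' := fun i => hasFDerivAt_pi'.1 hw.hasFDerivAt i
  have : HasFDerivAt (fun y => wedge u w y j k) _ x :=
    ((hu' j).mul (hw' k)).sub ((hw' j).mul (hu' k))
  rw [this.fderiv]
  simp

/-- The wedge of two commuting fields is a Poisson tensor. -/
theorem isPoissonOn_wedge {u w : (Fin m → ℝ) → Fin m → ℝ} {U : Set (Fin m → ℝ)} (hU : IsOpen U)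
    (hu : ContDiffOn ℝ ∞ u U) (hw : ContDiffOn ℝ ∞ w U)
    (hcomm : ∀ x ∈ U, fderiv ℝ u x (w x) = fderiv ℝ w x (u x)) :
    IsPoissonOn (wedge u w) U where
  smooth i j :=
    have hu' := contDiffOn_pi.1 hu
    have hw' := contDiffOn_pi.1 hw
    ((hu' i).mul (hw' j)).sub ((hw' i).mul (hu' j))
  antisymm x _ i j := by simp only [wedge, Matrix.of_apply]; ring
  jacobi x hx i j k := by
    have hud := (hu.contDiffAt (hU.mem_nhds hx)).differentiableAt (by simp)
    have hwd := (hw.contDiffAt (hU.mem_nhds hx)).differentiableAt (by simp)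
    simp only [Finset.sum_add_distrib, sum_wedge_mul_pderiv, fderiv_wedge_apply hud hwd,
      hcomm x hx]
    ring

theorem wedge_mulVec (u w : (Fin m → ℝ) → Fin m → ℝ) (x a : Fin m → ℝ) :
    (wedge u w x).mulVec a = (w x ⬝ᵥ a) • u x - (u x ⬝ᵥ a) • w x := by
  ext i
  simp only [wedge, Matrix.mulVec, dotProduct, Matrix.of_apply, sub_mul, Finset.sum_sub_distrib,
    Pi.sub_apply, Pi.smul_apply, smul_eq_mul, Finset.sum_mul]
  congr 1 <;> exact Finset.sum_congr rfl fun j _ => by ring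

/-- The image of `u ∧ w` is the span of `u` and `w`, which is a plane if the two vectors are
separated by a dual pair of covectors. -/
theorem rank_wedge {u w : (Fin m → ℝ) → Fin m → ℝ} {x a b : Fin m → ℝ}
    (hau : u x ⬝ᵥ a = 1) (haw : w x ⬝ᵥ a = 0) (hbu : u x ⬝ᵥ b = 0) (hbw : w x ⬝ᵥ b = 1) :
    (wedge u w x).rank = 2 := by
  have hli : LinearIndependent ℝ ![u x, w x] := by
    rw [LinearIndependent.pair_iff]
    intro s t hst
    have ha := congrArg (· ⬝ᵥ a) hst
    have hb := congrArg (· ⬝ᵥ b) hst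
    simp only [add_dotProduct, smul_dotProduct, hau, haw, hbu, hbw, zero_dotProduct,
      smul_eq_mul, mul_one, mul_zero, add_zero, zero_add] at ha hb
    exact ⟨ha, hb⟩
  have hrange : LinearMap.range (wedge u w x).mulVecLin = Submodule.span ℝ (range ![u x, w x]) := by
    rw [Matrix.range_cons, Matrix.range_cons, Matrix.range_empty, union_empty, singleton_union]
    apply le_antisymm
    · rintro _ ⟨c, rfl⟩
      rw [Matrix.mulVecLin_apply, wedge_mulVec]
      exact sub_mem (Submodule.smul_mem _ _ (Submodule.subset_span (by simp)))
        (Submodule.smul_mem _ _ (Submodule.subset_span (by simp)))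
    · rw [Submodule.span_le]
      rintro _ (rfl | rfl)
      · exact ⟨b, by rw [Matrix.mulVecLin_apply, wedge_mulVec, hbu, hbw]; simp⟩
      · exact ⟨-a, by
          rw [Matrix.mulVecLin_apply, wedge_mulVec, dotProduct_neg, dotProduct_neg, hau, haw]
          simp⟩
  rw [Matrix.rank, hrange, finrank_span_eq_card hli, Fintype.card_fin]

theorem hamiltonianField_wedge (u w : (Fin m → ℝ) → Fin m → ℝ) (H : (Fin m → ℝ) → ℝ)
    (x : Fin m → ℝ) :
    hamiltonianField (wedge u w) H x = fderiv ℝ H x (w x) • u x - fderiv ℝ H x (u x) • w x := by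
  ext i
  simp only [hamiltonianField, sum_wedge_mul_pderiv, Pi.sub_apply, Pi.smul_apply, smul_eq_mul]
  ring

/-- A function annihilated by `u` and `w` is a Casimir function of `u ∧ w`: it is constant on
symplectic leaves. -/
theorem eq_of_mem_symplecticLeaf_wedge {u w : (Fin m → ℝ) → Fin m → ℝ} {U : Set (Fin m → ℝ)}
    {f : (Fin m → ℝ) → ℝ} (hf : ∀ x ∈ U, DifferentiableAt ℝ f x)
    (hfu : ∀ x ∈ U, fderiv ℝ f x (u x) = 0) (hfw : ∀ x ∈ U, fderiv ℝ f x (w x) = 0)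
    {x y : Fin m → ℝ} (hy : y ∈ symplecticLeaf (wedge u w) U x) : f y = f x := by
  induction hy with
  | refl => rfl
  | tail _ hstep ih =>
    rw [← ih]
    obtain ⟨H, γ, T, -, hT, h0, h1, hγ⟩ := hstep
    have hd : ∀ t ∈ Icc 0 T, HasDerivWithinAt (f ∘ γ) 0 (Icc 0 T) t := by
      intro t ht
      obtain ⟨htU, hγt⟩ := hγ t ht
      refine ((hf _ htU).hasFDerivAt.comp_hasDerivWithinAt t hγt).congr_deriv ?_
      rw [hamiltonianField_wedge, map_sub, map_smul, map_smul, hfu _ htU, hfw _ htU]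
      simp
    have hconst := constant_of_has_deriv_right_zero (fun t ht => (hd t ht).continuousWithinAt)
      (fun t ht => (hd t (Ico_subset_Icc_self ht)).mono_of_mem_nhdsWithin
        (Icc_mem_nhdsGE_of_mem ht)) T (right_mem_Icc.2 hT)
    rwa [Function.comp_apply, Function.comp_apply, h0, h1] at hconst

end Bivector

/-! ### The Poisson tensors of a coordinate system -/

section Coordinates

variable {m : ℕ}

/-- The `a`-th coordinate function on the target of the local parametrization `e`. -/
def coord (e : OpenPartialHomeomorph (Fin m → ℝ) (Fin m → ℝ)) (a : Fin m)
    (x : Fin m → ℝ) : ℝ :=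
  e.symm x a

theorem contDiffOn_coord {e : OpenPartialHomeomorph (Fin m → ℝ) (Fin m → ℝ)}
    (hes : ContDiffOn ℝ ∞ e.symm e.target) (a : Fin m) : ContDiffOn ℝ ∞ (coord e a) e.target :=
  contDiffOn_pi.1 hes a

theorem differentiableAt_coord {e : OpenPartialHomeomorph (Fin m → ℝ) (Fin m → ℝ)}
    (hes : ContDiffOn ℝ ∞ e.symm e.target) (a : Fin m) {x : Fin m → ℝ} (hx : x ∈ e.target) :
    DifferentiableAt ℝ (coord e a) x :=
  ((contDiffOn_coord hes a).contDiffAt (e.open_target.mem_nhds hx)).differentiableAt (by simp)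

theorem fderiv_coord_coordFrame {e : OpenPartialHomeomorph (Fin m → ℝ) (Fin m → ℝ)}
    (he : ContDiffOn ℝ ∞ e e.source) (hes : ContDiffOn ℝ ∞ e.symm e.target) (a b : Fin m)
    {x : Fin m → ℝ} (hx : x ∈ e.target) :
    fderiv ℝ (coord e a) x (coordFrame e b x) = if a = b then 1 else 0 := by
  have hs := ((hes.contDiffAt (e.open_target.mem_nhds hx)).differentiableAt
    (by simp)).hasFDerivAt
  have h : HasFDerivAt (coord e a) _ x := hasFDerivAt_pi'.1 hs a
  rw [h.fderiv, ContinuousLinearMap.comp_apply, fderiv_symm_coordFrame he hes b hx]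
  simp [Pi.single_apply]

/-- The coordinate lines of `coord e b` are Hamiltonian for `∂_a ∧ ∂_b`, with Hamiltonian the
negative of the `a`-th coordinate; so the leaves are not contained in level sets of `coord e b`. -/
theorem exists_mem_symplecticLeaf_coord_ne {e : OpenPartialHomeomorph (Fin m → ℝ) (Fin m → ℝ)}
    (he : ContDiffOn ℝ ∞ e e.source) (hes : ContDiffOn ℝ ∞ e.symm e.target) {a b : Fin m}
    (hab : a ≠ b) {x : Fin m → ℝ} (hx : x ∈ e.target) :
    ∃ y ∈ symplecticLeaf (wedge (coordFrame e a) (coordFrame e b)) e.target x,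
      coord e b y ≠ coord e b x := by
  let line : ℝ → Fin m → ℝ := fun t => e.symm x + t • Pi.single b 1
  have hline : Continuous line := by fun_prop
  have hline0 : line 0 = e.symm x := by simp [line]
  obtain ⟨δ, hδ, hball⟩ := Metric.isOpen_iff.1 (e.open_source.preimage hline) 0
    (by rw [mem_preimage, hline0]; exact e.map_target hx)
  have hsrc : ∀ t ∈ Icc (0 : ℝ) (δ / 2), line t ∈ e.source := fun t ht => hball (by
    rw [mem_ball_zero_iff, Real.norm_of_nonneg ht.1]; linarith [ht.2])
  have hδ2 : 0 ≤ δ / 2 := by positivity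
  refine ⟨e (line (δ / 2)), Relation.ReflTransGen.single ⟨fun z => -coord e a z,
    fun t => e (line t), δ / 2, (contDiffOn_coord hes a).neg, hδ2, ?_, rfl, fun t ht => ⟨e.map_source (hsrc t ht), ?_⟩⟩,
    ?_⟩
  · change e (line 0) = x
    rw [hline0, e.right_inv hx]
  · have ht' := e.map_source (hsrc t ht)
    have hd : HasDerivAt line (Pi.single b 1) t :=
      (((hasDerivAt_id t).smul_const (Pi.single b 1 : Fin m → ℝ)).const_add
        (e.symm x)).congr_deriv (one_smul ℝ _)
    have hed := ((he.contDiffAt (e.open_source.mem_nhds (hsrc t ht))).differentiableAt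
      (by simp)).hasFDerivAt
    refine ((hed.comp_hasDerivAt t hd).congr_deriv ?_).hasDerivWithinAt
    rw [hamiltonianField_wedge, fderiv_fun_neg, neg_apply,
      neg_apply, fderiv_coord_coordFrame he hes _ _ ht',
      fderiv_coord_coordFrame he hes _ _ ht', if_neg hab, if_pos rfl, coordFrame,
      coordFrame, e.left_inv (hsrc t ht)]
    simp
  · simp only [coord, e.left_inv (hsrc _ ⟨hδ2, le_rfl⟩)]
    simp [line, hδ.ne']

end Coordinates

section IndependentFamily

variable {n : ℕ}

/-- The Poisson tensors `∂_0 ∧ ∂_k`, for `k = 1, …, n`, of a coordinate system. -/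
noncomputable def coordPoisson (e : OpenPartialHomeomorph (Fin (n + 1) → ℝ) (Fin (n + 1) → ℝ))
    (k : Fin n) : (Fin (n + 1) → ℝ) → Matrix (Fin (n + 1)) (Fin (n + 1)) ℝ :=
  wedge (coordFrame e 0) (coordFrame e k.succ)

theorem sum_coordPoisson_mul_pderiv_coord
    {e : OpenPartialHomeomorph (Fin (n + 1) → ℝ) (Fin (n + 1) → ℝ)}
    (he : ContDiffOn ℝ ∞ e e.source) (hes : ContDiffOn ℝ ∞ e.symm e.target) (k l : Fin n)
    {x : Fin (n + 1) → ℝ} (hx : x ∈ e.target) (i : Fin (n + 1)) :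
    ∑ j, coordPoisson e k x i j * pderiv j (coord e l.succ) x =
      if l = k then coordFrame e 0 x i else 0 := by
  rw [coordPoisson, sum_wedge_mul_pderiv, fderiv_coord_coordFrame he hes _ _ hx,
    fderiv_coord_coordFrame he hes _ _ hx, if_neg (Fin.succ_ne_zero l)]
  simp

theorem independentOn_coordPoisson
    {e : OpenPartialHomeomorph (Fin (n + 1) → ℝ) (Fin (n + 1) → ℝ)}
    (he : ContDiffOn ℝ ∞ e e.source) (hes : ContDiffOn ℝ ∞ e.symm e.target) :
    IndependentOn (coordPoisson e) e.target where
  linearIndependent x hx := by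
    rw [Fintype.linearIndependent_iff]
    intro g hg l
    have hne : coordFrame e 0 x ≠ 0 := by
      intro h
      simpa [h] using fderiv_coord_coordFrame he hes 0 0 hx
    obtain ⟨i, hi⟩ := Function.ne_iff.1 hne
    -- contract the relation with the differential of the coordinate `l.succ`
    have h1 : ∑ j, (∑ k, g k • coordPoisson e k x) i j * pderiv j (coord e l.succ) x = 0 := by
      rw [hg]; simp
    simp only [Matrix.sum_apply, Matrix.smul_apply, smul_eq_mul, Finset.sum_mul, mul_assoc] at h1
    rw [Finset.sum_comm] at h1
    simp only [← Finset.mul_sum, sum_coordPoisson_mul_pderiv_coord he hes _ _ hx] at h1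
    simpa [show coordFrame e 0 x i ≠ 0 from hi] using h1
  leaf_ne x hx k l hkl h := by
    obtain ⟨y, hy, hne⟩ := exists_mem_symplecticLeaf_coord_ne he hes (Fin.succ_ne_zero k).symm hx
    refine hne (eq_of_mem_symplecticLeaf_wedge (fun z hz => differentiableAt_coord hes k.succ hz)
      (fun z hz => ?_) (fun z hz => ?_) (h ▸ hy : y ∈ symplecticLeaf (coordPoisson e l) _ x))
    · rw [fderiv_coord_coordFrame he hes _ _ hz, if_neg (Fin.succ_ne_zero k)]
    · rw [fderiv_coord_coordFrame he hes _ _ hz, if_neg (by simpa using hkl)]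

end IndependentFamily

end LocalPoisson

theorem mainTheorem1 (n : ℕ) (v : (Fin (n + 1) → ℝ) → (Fin (n + 1) → ℝ))
    (hv : ContDiff ℝ ∞ v) (p : Fin (n + 1) → ℝ) (hp : v p ≠ 0) :
    ∃ (U : Set (Fin (n + 1) → ℝ)) (Φ : (Fin (n + 1) → ℝ) → ℝ)
      (Λ : Fin n → (Fin (n + 1) → ℝ) → Matrix (Fin (n + 1)) (Fin (n + 1)) ℝ),
      IsOpen U ∧ p ∈ U ∧
      ContDiffOn ℝ 2 Φ U ∧
      (∀ k, LocalPoisson.IsPoissonOn (Λ k) U) ∧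
      (∀ k, ∀ x ∈ U, (Λ k x).rank = 2) ∧
      LocalPoisson.IndependentOn Λ U ∧
      ∀ k, ∀ x ∈ U, ∀ i, v x i = ∑ j, Λ k x i j * LocalPoisson.pderiv j Φ x := by
  obtain ⟨e, hpe, he, hes, hev⟩ := LocalPoisson.exists_flowBox n v hv p hp
  refine ⟨e.target, fun x => ∑ l : Fin n, LocalPoisson.coord e l.succ x,
    LocalPoisson.coordPoisson e, e.open_target, hpe, ?_, fun k => ?_, fun k x hx => ?_,
    LocalPoisson.independentOn_coordPoisson he hes, fun k x hx i => ?_⟩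
  · exact ContDiffOn.sum fun l _ => (LocalPoisson.contDiffOn_coord hes _).of_le
      (WithTop.coe_le_coe.2 (le_top : (2 : ℕ∞) ≤ ⊤))
  · exact LocalPoisson.isPoissonOn_wedge e.open_target (LocalPoisson.contDiffOn_coordFrame he hes 0)
      (LocalPoisson.contDiffOn_coordFrame he hes k.succ)
      fun x hx => LocalPoisson.fderiv_coordFrame_comm he hes _ _ hx
  · refine LocalPoisson.rank_wedge
      (a := fun j => LocalPoisson.pderiv j (LocalPoisson.coord e 0) x)
      (b := fun j => LocalPoisson.pderiv j (LocalPoisson.coord e k.succ) x) ?_ ?_ ?_ ?_ <;>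
    rw [dotProduct, LocalPoisson.sum_mul_pderiv,
      LocalPoisson.fderiv_coord_coordFrame he hes _ _ hx] <;> simp [eq_comm]
  · have hΦ : ∀ j, LocalPoisson.pderiv j (fun x => ∑ l : Fin n, LocalPoisson.coord e l.succ x) x =
        ∑ l : Fin n, LocalPoisson.pderiv j (LocalPoisson.coord e l.succ) x := by
      intro j
      simp only [LocalPoisson.pderiv]
      rw [fderiv_fun_sum fun l _ => LocalPoisson.differentiableAt_coord hes l.succ hx,
        sum_apply]
    simp only [hΦ, Finset.mul_sum]
    rw [Finset.sum_comm]
    simp only [LocalPoisson.sum_coordPoisson_mul_pderiv_coord he hes _ _ hx, Finset.sum_ite_eq',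
      Finset.mem_univ, if_true]
    rw [LocalPoisson.coordFrame, hev _ (e.map_target hx), e.right_inv hx]
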